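/- For integers $\ell\ge 1$ and $n\ge 0$ let $S_n$ be the symmetric group on $n$ letters and let $$N_\ell(n)=\frac{1}{n!}\,\bigl|\{(\pi_1,\dots,\pi_\ell)\in S_n^\ell : \pi_j\pi_k=\pi_k\pi_j \text{ for all } 1\le j,k\le \ell\}\bigr|.$$ For integers $a,b\ge 2$ put $\Delta_{a,b}^{\ell}=N_\ell(a)\,N_\ell(b)-N_\ell(a+b)$. "For almost all $\ell$" means for all but finitely many positive integers $\ell$. Fix integers $a,b\ge 2$. - Suppose $a\equiv 0\pmod 3$ or $b\equiv 0\pmod 3$. If $(a,b)\notin\{(3,2),(3,4),(2,3),(4,3)\}$, then $\Delta_{a,b}^{\ell}>0$ for almost all $\ell$. If $(a,b)\in\{(3,2),(3,4),(2,3),(4,3)\}$, then $\Delta_{a,b}^{\ell}<0$ for almost all $\ell$. - Suppose $a\not\equiv 0\pmod 3$ and $b\not\equiv 0\pmod 3$, and $a,b$ are not both $\equiv 2\pmod 3$. Then $\Delta_{a,b}^{\ell}<0$ for almost all $\ell$. - Suppose $a\equiv b\equiv 2\pmod 3$. If $a>2$ and $b>2$, then $\Delta_{a,b}^{\ell}>0$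 for almost all $\ell$. If $a=2$ or $b=2$, then $\Delta_{a,b}^{\ell}<0$ for almost all $\ell$. -/

import Mathlib

/-- The set of `ℓ`-tuples of pairwise commuting permutations in the symmetric group `S_n`. -/
def commutingTuples (ℓ n : ℕ) : Set (Fin ℓ → Equiv.Perm (Fin n)) :=
  {π | ∀ j k : Fin ℓ, π j * π k = π k * π j}

/-- `N_ℓ(n)`: the number of `ℓ`-tuples of pairwise commuting permutations in `S_n`,
divided by `n!`. The quotient is taken in `ℚ`, so it is exact. -/
noncomputable def commutingNumber (ℓ n : ℕ) : ℚ :=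
  (Nat.card (commutingTuples ℓ n) : ℚ) / (Nat.factorial n : ℚ)

/-- `Δ_{a,b}^ℓ = N_ℓ(a) N_ℓ(b) - N_ℓ(a+b)`. -/
noncomputable def bessenrodtOnoDelta (ℓ a b : ℕ) : ℚ :=
  commutingNumber ℓ a * commutingNumber ℓ b - commutingNumber ℓ (a + b)

/-! Splitting a commuting tuple along the orbit of a point gives the exponential formula `∑ N_ℓ(n)
X^n = exp (∑ s_m X^m / m)` with `s_m = transitiveNumber ℓ m`. A transitive abelian group of degree
`m` has order `m`, so `s_m ~ c_m * m ^ ℓ`, where `(m - 1)! * c_m` counts such subgroups. As `ℓ → ∞`,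
`N_ℓ(n)` is governed by the partitions of `n` with the largest product of parts `M(n)`: `3 ^ k`, `2
* 3 ^ k`, `4 * 3 ^ k` for `n = 3k`, `3k + 2`, `3k + 4`, the parts `4` and `2 + 2` being tied.

For residues `{1, 1}` and `{1, 2}` one has `M(a) M(b) < M(a + b)` (`16 < 18`, `8 < 9`), so `Δ < 0`.
In all other cases `M(a) M(b) = M(a + b)` and the constants decide. With `i, j` threes in `a, b`,
the factor `1 / (i! j!)` competes with `1 / (i + j)!`, and `(i + j).choose i ≥ 2` makes `Δ > 0` if
`i, j ≥ 1`.

This leaves `b ∈ {2, 4}` up to symmetry. For `a ≡ 2`, `b = 2` the constants compare as `1/4 < 7/24`.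
For `3 ∣ a` the leading terms cancel. Let `E(n)` be the coefficients left after removing the factor
`exp (s_3 X^3 / 3)`. Then `E(3) E(b) - E(3 + b)` is negative of base `5` (resp. `10`), because of an
orbit of length `5`, while `E(6) E(b) - E(6 + b)` is positive of base `16` (resp. `32`) but has one
factor `3` fewer. Since `16 > 15` and `32 > 30`, it wins whenever present, that is, unless `a = 3`.
-/

section CommutingTuples

open Filter Topology Finset

/-! ### Exponential growth rates -/

/-- `f ℓ ~ c * B ^ ℓ` in the sense that `f ℓ / B ^ ℓ` tends to `c` (where `c = 0` is allowed). -/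
def HasGrowth (f : ℕ → ℝ) (B c : ℝ) : Prop :=
  Tendsto (fun ℓ => f ℓ / B ^ ℓ) atTop (𝓝 c)

namespace HasGrowth

variable {f g : ℕ → ℝ} {A B c d : ℝ}

theorem add (hf : HasGrowth f B c) (hg : HasGrowth g B d) :
    HasGrowth (fun ℓ => f ℓ + g ℓ) B (c + d) :=
  (Tendsto.add hf hg).congr fun ℓ => by ring

theorem sub (hf : HasGrowth f B c) (hg : HasGrowth g B d) :
    HasGrowth (fun ℓ => f ℓ - g ℓ) B (c - d) :=
  (Tendsto.sub hf hg).congr fun ℓ => by ring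

theorem mul (hf : HasGrowth f A c) (hg : HasGrowth g B d) :
    HasGrowth (fun ℓ => f ℓ * g ℓ) (A * B) (c * d) :=
  (Tendsto.mul hf hg).congr fun ℓ => by rw [mul_pow, div_mul_div_comm]

theorem const (c : ℝ) : HasGrowth (fun _ => c) 1 c := by
  simp [HasGrowth]

theorem mul_const (hf : HasGrowth f B c) (a : ℝ) : HasGrowth (fun ℓ => f ℓ * a) B (c * a) := by
  simpa using hf.mul (const a)

theorem div_const (hf : HasGrowth f B c) (a : ℝ) : HasGrowth (fun ℓ => f ℓ / a) B (c / a) := by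
  simpa only [div_eq_mul_inv] using hf.mul_const a⁻¹

theorem pow (hf : HasGrowth f B c) (n : ℕ) : HasGrowth (fun ℓ => f ℓ ^ n) (B ^ n) (c ^ n) :=
  (Tendsto.pow hf n).congr fun ℓ => by rw [div_pow, ← pow_mul, ← pow_mul, mul_comm]

theorem sum {ι : Type*} {F : ι → ℕ → ℝ} {C : ι → ℝ} (s : Finset ι)
    (h : ∀ i ∈ s, HasGrowth (F i) B (C i)) :
    HasGrowth (fun ℓ => ∑ i ∈ s, F i ℓ) B (∑ i ∈ s, C i) :=
  (tendsto_finsetSum s h).congr fun _ => (Finset.sum_div _ _ _).symm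

theorem base_pow (hB : B ≠ 0) : HasGrowth (fun ℓ => B ^ ℓ) B 1 :=
  tendsto_const_nhds.congr fun ℓ => (div_self (pow_ne_zero ℓ hB)).symm

theorem zero : HasGrowth (fun _ => 0) B 0 := by
  simp [HasGrowth]

theorem weaken (hf : HasGrowth f A c) (hA : 0 < A) (hAB : A < B) : HasGrowth f B 0 := by
  have h : Tendsto (fun ℓ : ℕ => (A / B) ^ ℓ) atTop (𝓝 0) :=
    tendsto_pow_atTop_nhds_zero_of_lt_one (by have := hA.trans hAB; positivity)
      ((div_lt_one (hA.trans hAB)).2 hAB)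
  have h' := Tendsto.mul hf h
  rw [mul_zero] at h'
  refine h'.congr fun ℓ => ?_
  rw [div_pow, div_mul_div_comm, mul_comm (A ^ ℓ), mul_div_mul_right _ _ (pow_ne_zero ℓ hA.ne')]

theorem congr (hf : HasGrowth f B c) (h : ∀ ℓ, f ℓ = g ℓ) (hAB : B = A) (hcd : c = d) :
    HasGrowth g A d := by
  obtain rfl : f = g := funext h
  subst hAB hcd
  exact hf

theorem eventually_pos (hf : HasGrowth f B c) (hB : 0 < B) (hc : 0 < c) :
    ∀ᶠ ℓ in atTop, 0 < f ℓ := by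
  filter_upwards [Tendsto.eventually_const_lt hc hf] with ℓ hℓ
  exact (div_pos_iff_of_pos_right (pow_pos hB ℓ)).1 hℓ

theorem eventually_neg (hf : HasGrowth f B c) (hB : 0 < B) (hc : c < 0) :
    ∀ᶠ ℓ in atTop, f ℓ < 0 := by
  have := (zero.sub hf).eventually_pos hB (by linarith)
  filter_upwards [this] with ℓ hℓ
  linarith

end HasGrowth

/-! ### Exponentials of power series -/

/-- The coefficients of `exp (∑ s m * X ^ m / m)`. -/
noncomputable def expSeq (s : ℕ → ℝ) : ℕ → ℝ
  | 0 => 1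
  | n + 1 => (∑ m : Fin (n + 1), s (m + 1) * expSeq s (n - m)) / (n + 1)
  decreasing_by omega

@[simp] theorem expSeq_zero (s : ℕ → ℝ) : expSeq s 0 = 1 := by rw [expSeq]

theorem expSeq_succ (s : ℕ → ℝ) (n : ℕ) :
    expSeq s (n + 1) = (∑ m ∈ range (n + 1), s (m + 1) * expSeq s (n - m)) / (n + 1) := by
  rw [expSeq, Fin.sum_univ_eq_sum_range (fun m => s (m + 1) * expSeq s (n - m))]

theorem eq_expSeq {s f : ℕ → ℝ} (h0 : f 0 = 1)
    (h : ∀ n : ℕ, (n + 1) * f (n + 1) = ∑ m ∈ range (n + 1), s (m + 1) * f (n - m)) (n : ℕ) :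
    f n = expSeq s n := by
  induction n using Nat.strong_induction_on with
  | _ n ih =>
    cases n with
    | zero => simp [h0]
    | succ n =>
      rw [expSeq_succ, eq_div_iff (by positivity), mul_comm, h]
      exact sum_congr rfl fun m _ => by rw [ih (n - m) (by omega)]

/-- The recurrence is homogeneous when `s m` has weight `m`, so limits can be taken term by term. -/
theorem expSeq_hasGrowth {s : ℕ → ℕ → ℝ} {r : ℝ} {σ : ℕ → ℝ}
    (h : ∀ m, 1 ≤ m → HasGrowth (fun ℓ => s ℓ m) (r ^ m) (σ m)) (n : ℕ) :
    HasGrowth (fun ℓ => expSeq (s ℓ) n) (r ^ n) (expSeq σ n) := by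
  induction n using Nat.strong_induction_on with
  | _ n ih =>
    cases n with
    | zero => simpa using HasGrowth.const 1
    | succ n =>
      simp only [expSeq_succ]
      refine (HasGrowth.sum _ fun m hm => ?_).div_const _
      refine ((h (m + 1) (by omega)).mul (ih (n - m) (by omega))).congr (fun _ => rfl) ?_ rfl
      rw [← pow_add]
      congr 1
      have := mem_range.1 hm
      omega

open PowerSeries in
theorem X_mul_derivative_expSeq (s : ℕ → ℝ) :
    X * d⁄dX ℝ (PowerSeries.mk (expSeq s)) =
      X * PowerSeries.mk (fun m => s (m + 1)) * PowerSeries.mk (expSeq s) := by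
  rw [mul_assoc]
  congr 1
  ext n
  rw [coeff_derivative, coeff_mk, coeff_mul, expSeq_succ, div_mul_cancel₀ _ (by positivity),
    Nat.sum_antidiagonal_eq_sum_range_succ_mk]
  simp

open PowerSeries in
-- The product has the sum of the logarithmic derivatives, and the resulting recurrence has only one
-- solution with constant term `1`.
theorem expSeq_add (s t : ℕ → ℝ) :
    PowerSeries.mk (expSeq (s + t)) = PowerSeries.mk (expSeq s) * PowerSeries.mk (expSeq t) := by
  set P := PowerSeries.mk (expSeq s) * PowerSeries.mk (expSeq t) with hP
  have hd : d⁄dX ℝ P = PowerSeries.mk (fun m => (s + t) (m + 1)) * P := by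
    have hX : (X : PowerSeries ℝ) ≠ 0 := X_ne_zero
    apply mul_left_cancel₀ hX
    have e : PowerSeries.mk (fun m => (s + t) (m + 1)) =
        PowerSeries.mk (fun m => s (m + 1)) + PowerSeries.mk (fun m => t (m + 1)) := by
      ext; simp
    rw [hP, Derivation.leibniz, e]
    simp only [smul_eq_mul]
    linear_combination PowerSeries.mk (expSeq t) * X_mul_derivative_expSeq s +
      PowerSeries.mk (expSeq s) * X_mul_derivative_expSeq t
  ext n
  rw [coeff_mk]
  refine (eq_expSeq (f := fun n => coeff n P) ?_ (fun n => ?_) n).symm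
  · simp [hP]
  · have := congrArg (coeff n) hd
    rw [coeff_derivative] at this
    rw [mul_comm, this, coeff_mul, Nat.sum_antidiagonal_eq_sum_range_succ_mk]
    simp

/-! ### Splitting off the cubic term of the exponent -/

theorem expSeq_single_three (x : ℝ) (n : ℕ) :
    expSeq (Pi.single 3 (3 * x)) n = if 3 ∣ n then x ^ (n / 3) / (n / 3).factorial else 0 := by
  refine (eq_expSeq (f := fun n => if 3 ∣ n then x ^ (n / 3) / (n / 3).factorial else 0)
    (by simp) (fun n => ?_) n).symm
  by_cases hn : 2 ≤ n
  · rw [Finset.sum_eq_single_of_mem 2 (by simp; omega)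
      (fun m _ hm => by rw [Pi.single_eq_of_ne (by omega), zero_mul])]
    obtain ⟨n, rfl⟩ := Nat.exists_eq_add_of_le' hn
    have e : n + 2 + 1 = n + 3 := rfl
    simp only [Pi.single_eq_same, Nat.add_sub_cancel, e]
    by_cases h : 3 ∣ n
    · obtain ⟨k, rfl⟩ := h
      rw [if_pos (by omega), if_pos (by omega), show (3 * k + 3) / 3 = k + 1 by omega,
        show 3 * k / 3 = k by omega, Nat.factorial_succ]
      push_cast
      field_simp
      ring
    · rw [if_neg (by omega), if_neg h]
      simp
  · rw [Finset.sum_eq_zero fun m hm => by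
      rw [Pi.single_eq_of_ne (by have := mem_range.1 hm; omega), zero_mul], if_neg (by omega),
      mul_zero]

/-- The value at `k` of the convolution of `x ^ j / j!` with `f`. -/
noncomputable def expConv (x : ℝ) (k : ℕ) (f : ℕ → ℝ) : ℝ :=
  ∑ d ∈ range (k + 1), x ^ (k - d) / (k - d).factorial * f d

theorem expConv_succ (x : ℝ) (k : ℕ) (f : ℕ → ℝ) :
    expConv x (k + 1) f =
      x ^ (k + 1) / (k + 1).factorial * f 0 + expConv x k (fun d => f (d + 1)) := by
  rw [expConv, sum_range_succ', add_comm, expConv]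
  simp

theorem expConv_mul (x : ℝ) (k : ℕ) (f : ℕ → ℝ) (a : ℝ) :
    expConv x k f * a = expConv x k (fun d => f d * a) := by
  simp only [expConv, sum_mul, mul_assoc]

theorem expConv_sub (x : ℝ) (k : ℕ) (f g : ℕ → ℝ) :
    expConv x k f - expConv x k g = expConv x k (fun d => f d - g d) := by
  simp only [expConv, ← sum_sub_distrib, mul_sub]

theorem sum_range_three_mul {F : ℕ → ℝ} (hF : ∀ p, ¬ 3 ∣ p → F p = 0) {r : ℕ} (hr : r < 3) (k : ℕ) :
    ∑ p ∈ range (3 * k + r + 1), F p = ∑ j ∈ range (k + 1), F (3 * j) := by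
  induction k with
  | zero =>
    rw [Finset.sum_eq_single_of_mem 0 (by simp)
      (fun p hp hp0 => hF p (by have := mem_range.1 hp; omega))]
    simp
  | succ k ih =>
    rw [sum_range_succ _ (k + 1), ← ih, show 3 * (k + 1) + r + 1 = 3 * k + r + 1 + 3 by ring,
      sum_range_add _ (3 * k + r + 1) 3]
    congr 1
    -- Of the three new indices, `3k + r + 1 + (2 - r) = 3(k + 1)` is the multiple of `3`.
    rw [Finset.sum_eq_single_of_mem (2 - r) (by simp; omega)
      (fun p hp hp0 => hF _ (by have := mem_range.1 hp; omega))]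
    congr 1
    omega

/-- The series is `exp (s 3 * X ^ 3 / 3)` times the series with `s 3` erased, and the first factor
only has exponents divisible by `3`. -/
theorem expSeq_three_mul_add (s : ℕ → ℝ) (k : ℕ) {r : ℕ} (hr : r < 3) :
    expSeq s (3 * k + r) =
      expConv (s 3 / 3) k fun d => expSeq (Function.update s 3 0) (3 * d + r) := by
  have e : s = Pi.single 3 (3 * (s 3 / 3)) + Function.update s 3 0 := by
    ext m
    by_cases hm : m = 3
    · subst hm; simp; ring
    · simp [hm]
  have := congrArg (PowerSeries.coeff (3 * k + r))
    (expSeq_add (Pi.single 3 (3 * (s 3 / 3))) (Function.update s 3 0))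
  rw [← e, PowerSeries.coeff_mk, PowerSeries.coeff_mul,
    Nat.sum_antidiagonal_eq_sum_range_succ_mk] at this
  -- The product is indexed by the exponent of `x`; reflection passes to the index `d` of `expConv`.
  rw [this, sum_range_three_mul _ hr, expConv, ← sum_range_reflect]
  · refine sum_congr rfl fun j hj => ?_
    have hj' := mem_range.1 hj
    simp only [PowerSeries.coeff_mk, expSeq_single_three]
    rw [if_pos (by omega), show 3 * (k + 1 - 1 - j) / 3 = k - j by omega]
    congr 2
    omega
  · intro p hp
    simp [expSeq_single_three, hp]

/-- Term `d` has base `3 ^ (k - d) * A * β ^ d`; as `β < 3`, only `d = 0` survives in the limit. -/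
theorem expConv_hasGrowth {x : ℕ → ℝ} {f : ℕ → ℕ → ℝ} {y A β : ℝ} {c : ℕ → ℝ}
    (hx : HasGrowth x 3 y) (hA : 0 < A) (hβ : 0 < β) (hβ3 : β < 3)
    (hf : ∀ d, HasGrowth (fun ℓ => f ℓ d) (A * β ^ d) (c d)) (k : ℕ) :
    HasGrowth (fun ℓ => expConv (x ℓ) k (f ℓ)) (3 ^ k * A) (y ^ k / k.factorial * c 0) := by
  have key : ∀ d ∈ range (k + 1),
      HasGrowth (fun ℓ => x ℓ ^ (k - d) / (k - d).factorial * f ℓ d) (3 ^ k * A)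
        (if d = 0 then y ^ k / k.factorial * c 0 else 0) := by
    intro d hd
    have hd' := mem_range.1 hd
    have h := ((hx.pow (k - d)).div_const (k - d).factorial).mul (hf d)
    split_ifs with h0
    · subst h0
      exact h.congr (fun _ => rfl) (by simp) (by simp)
    · refine h.weaken (by positivity) ?_
      obtain ⟨e, rfl⟩ := Nat.exists_eq_add_of_le' (Nat.lt_succ_iff.1 hd')
      rw [Nat.add_sub_cancel, pow_add, mul_assoc, mul_comm _ A]
      gcongr
  refine (HasGrowth.sum _ key).congr (fun _ => rfl) rfl ?_
  simp

/-! ### Orbit decomposition of commuting tuples -/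

/-- A tuple of permutations is transitive if the subgroup it generates acts transitively. -/
def IsTransitiveTuple {ι α : Type*} (π : ι → Equiv.Perm α) : Prop :=
  ∀ x y, ∃ g ∈ Subgroup.closure (Set.range π), g x = y

/-- The set of tuples, indexed by `ι`, of pairwise commuting permutations of `α`. -/
def commutingPerms (ι α : Type*) : Set (ι → Equiv.Perm α) :=
  {π | ∀ j k, π j * π k = π k * π j}

/-- The set of transitive tuples, indexed by `ι`, of pairwise commuting permutations of `α`. -/
def transitiveCommutingPerms (ι α : Type*) : Set (ι → Equiv.Perm α) :=
  {π | π ∈ commutingPerms ι α ∧ IsTransitiveTuple π}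

/-- The set of commuting tuples for which the orbit of `a` is `{x | p x}`. -/
def commutingPermsOfOrbit (ι : Type*) {α : Type*} (a : α) (p : α → Prop) :
    Set (ι → Equiv.Perm α) :=
  {π | π ∈ commutingPerms ι α ∧ ∀ x, p x ↔ ∃ g ∈ Subgroup.closure (Set.range π), g a = x}

section Congr

variable {ι α β : Type*}

theorem isTransitiveTuple_iff_of_base (π : ι → Equiv.Perm α) (a : α) :
    IsTransitiveTuple π ↔ ∀ x, ∃ g ∈ Subgroup.closure (Set.range π), g a = x := by
  refine ⟨fun h => h a, fun h x y => ?_⟩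
  obtain ⟨g, hg, rfl⟩ := h x
  obtain ⟨g', hg', rfl⟩ := h y
  exact ⟨g' * g⁻¹, mul_mem hg' (inv_mem hg), by simp⟩

theorem range_comp_hom_closure {G H : Type*} [Group G] [Group H] (φ : G →* H) (π : ι → G) :
    Subgroup.closure (Set.range fun j => φ (π j)) = (Subgroup.closure (Set.range π)).map φ := by
  rw [MonoidHom.map_closure, ← Set.range_comp]
  rfl

theorem card_commutingPerms_congr (e : α ≃ β) :
    Nat.card (commutingPerms ι α) = Nat.card (commutingPerms ι β) := by
  refine Nat.card_congr ((Equiv.piCongrRight fun _ => e.permCongrHom.toEquiv).subtypeEquiv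
    fun π => forall₂_congr fun j k => ?_)
  change _ ↔ e.permCongrHom (π j) * e.permCongrHom (π k) =
    e.permCongrHom (π k) * e.permCongrHom (π j)
  rw [← map_mul, ← map_mul, e.permCongrHom.injective.eq_iff]

theorem card_transitiveCommutingPerms_congr (e : α ≃ β) :
    Nat.card (transitiveCommutingPerms ι α) = Nat.card (transitiveCommutingPerms ι β) := by
  refine Nat.card_congr ((Equiv.piCongrRight fun _ => e.permCongrHom.toEquiv).subtypeEquiv
    fun π => and_congr (forall₂_congr fun j k => ?_) ?_)
  · change _ ↔ e.permCongrHom (π j) * e.permCongrHom (π k) =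
      e.permCongrHom (π k) * e.permCongrHom (π j)
    rw [← map_mul, ← map_mul, e.permCongrHom.injective.eq_iff]
  · change _ ↔ IsTransitiveTuple fun j => e.permCongrHom.toMonoidHom (π j)
    simp only [IsTransitiveTuple, range_comp_hom_closure, Subgroup.mem_map]
    constructor
    · intro h x y
      obtain ⟨g, hg, hx⟩ := h (e.symm x) (e.symm y)
      exact ⟨_, ⟨g, hg, rfl⟩, by simp [Equiv.permCongrHom, hx]⟩
    · intro h x y
      obtain ⟨_, ⟨g, hg, rfl⟩, hx⟩ := h (e x) (e y)
      exact ⟨g, hg, by simpa [Equiv.permCongrHom] using hx⟩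

end Congr

section Orbit

variable {ι α : Type*}

/-- An orbit and its complement are both invariant, so the tuple is a transitive commuting tuple on
the orbit together with an arbitrary commuting tuple on the complement. -/
theorem card_commutingPermsOfOrbit (a : α) (p : α → Prop) [DecidablePred p] (ha : p a) :
    Nat.card (commutingPermsOfOrbit ι a p) =
      Nat.card (transitiveCommutingPerms ι {x // p x}) *
        Nat.card (commutingPerms ι {x // ¬ p x}) := by
  rw [← Nat.card_prod]
  symm
  set φ := Equiv.Perm.subtypeCongrHom p with hφ
  have hinj : Function.Injective φ := Equiv.Perm.subtypeCongrHom_injective p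
  have hφl : ∀ q x, (hx : p x) → φ q x = q.1 ⟨x, hx⟩ := fun q x hx =>
    Equiv.Perm.subtypeCongr.left_apply q.1 q.2 hx
  have hmem : ∀ q : ι → Equiv.Perm {x // p x} × Equiv.Perm {x // ¬ p x},
      (fun j => φ (q j)) ∈ commutingPermsOfOrbit ι a p ↔
        (fun j => (q j).1) ∈ transitiveCommutingPerms ι {x // p x} ∧
          (fun j => (q j).2) ∈ commutingPerms ι {x // ¬ p x} := by
    intro q
    have h1 : (fun j => φ (q j)) ∈ commutingPerms ι α ↔
        (fun j => (q j).1) ∈ commutingPerms ι {x // p x} ∧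
          (fun j => (q j).2) ∈ commutingPerms ι {x // ¬ p x} := by
      simp only [commutingPerms, Set.mem_ofPred_eq, ← map_mul, hinj.eq_iff, Prod.ext_iff,
        Prod.fst_mul, Prod.snd_mul, forall_and]
    have h2 : (∀ x, p x ↔ ∃ g ∈ Subgroup.closure (Set.range fun j => φ (q j)), g a = x) ↔
        IsTransitiveTuple fun j => (q j).1 := by
      rw [isTransitiveTuple_iff_of_base _ ⟨a, ha⟩, range_comp_hom_closure]
      have := range_comp_hom_closure (MonoidHom.fst (Equiv.Perm {x // p x})
        (Equiv.Perm {x // ¬ p x})) q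
      simp only [MonoidHom.coe_fst] at this
      rw [this]
      simp only [Subgroup.mem_map, MonoidHom.coe_fst, exists_exists_and_eq_and, hφl _ _ ha]
      constructor
      · rintro h ⟨x, hx⟩
        obtain ⟨g, hg, e⟩ := (h x).1 hx
        exact ⟨g, hg, Subtype.ext e⟩
      · intro h x
        refine ⟨fun hx => ?_, ?_⟩
        · obtain ⟨g, hg, e⟩ := h ⟨x, hx⟩
          exact ⟨g, hg, congrArg Subtype.val e⟩
        · rintro ⟨g, hg, rfl⟩
          exact (g.1 ⟨a, ha⟩).2
    rw [commutingPermsOfOrbit, transitiveCommutingPerms, Set.mem_ofPred_eq, Set.mem_ofPred_eq,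
      h1, h2]
    tauto
  refine Nat.card_congr (Equiv.ofBijective
    (fun q => ⟨fun j => φ (q.1.1 j, q.2.1 j), (hmem _).2 ⟨q.1.2, q.2.2⟩⟩) ⟨?_, ?_⟩)
  · rintro ⟨⟨q, _⟩, ⟨r, _⟩⟩ ⟨⟨q', _⟩, ⟨r', _⟩⟩ h
    have h' := fun j => hinj (congrFun (congrArg Subtype.val h) j)
    simp only [Prod.ext_iff] at h'
    obtain rfl : q = q' := funext fun j => (h' j).1
    obtain rfl : r = r' := funext fun j => (h' j).2
    rfl
  · rintro ⟨π, hπ⟩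
    have hp : ∀ j x, p (π j x) ↔ p x := by
      intro j x
      have hj : π j ∈ Subgroup.closure (Set.range π) := Subgroup.subset_closure ⟨j, rfl⟩
      rw [hπ.2, hπ.2]
      constructor
      · rintro ⟨g, hg, e⟩
        exact ⟨(π j)⁻¹ * g, mul_mem (inv_mem hj) hg, by simp [e]⟩
      · rintro ⟨g, hg, rfl⟩
        exact ⟨π j * g, mul_mem hj hg, rfl⟩
    let q : ι → Equiv.Perm {x // p x} × Equiv.Perm {x // ¬ p x} := fun j =>
      ((π j).subtypePerm (hp j), (π j).subtypePerm fun x => not_congr (hp j x))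
    have hq : (fun j => φ (q j)) = π := by
      ext j x
      by_cases hx : p x
      · simp [hφl _ _ hx, q]
      · exact Equiv.Perm.subtypeCongr.right_apply _ _ hx
    have := (hmem q).1 (by rwa [hq])
    exact ⟨⟨⟨_, this.1⟩, ⟨_, this.2⟩⟩, Subtype.ext hq⟩

theorem card_commutingPerms_eq_sum [Finite ι] [Fintype α] [DecidableEq α] (a : α) :
    Nat.card (commutingPerms ι α) =
      ∑ S ∈ univ.filter (fun S : Finset α => a ∈ S),
        Nat.card (commutingPermsOfOrbit ι a (· ∈ S)) := by
  classical
  have := Fintype.ofFinite ι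
  let orb : (ι → Equiv.Perm α) → Finset α := fun π =>
    univ.filter fun x => ∃ g ∈ Subgroup.closure (Set.range π), g a = x
  have h : ∀ T : Set (ι → Equiv.Perm α), Nat.card T = (univ.filter (· ∈ T)).card := by
    intro T
    rw [Nat.card_eq_fintype_card, Fintype.card_subtype]
  rw [h, card_eq_sum_card_fiberwise (f := orb) (t := univ.filter (fun S : Finset α => a ∈ S))]
  · refine sum_congr rfl fun S _ => ?_
    rw [h, filter_filter]
    congr 1
    ext π
    rw [mem_filter_univ, mem_filter_univ]
    simp only [mem_filter_univ, commutingPermsOfOrbit, Set.mem_ofPred_eq, orb, Finset.ext_iff]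
    exact and_congr_right fun _ => forall_congr' fun _ => Iff.comm
  · intro π _
    simp only [coe_filter, mem_univ, true_and, Set.mem_ofPred_eq, orb, mem_filter]
    exact ⟨1, one_mem _, rfl⟩

end Orbit

theorem sum_filter_mem_apply_card {M α : Type*} [AddCommMonoid M] [Fintype α] [DecidableEq α]
    (a : α) (f : ℕ → M) :
    ∑ S ∈ univ.filter (fun S : Finset α => a ∈ S), f S.card =
      ∑ m ∈ range (Fintype.card α), (Fintype.card α - 1).choose m • f (m + 1) := by
  have hc : (univ.erase a).card = Fintype.card α - 1 := by simp
  have hpos : 0 < Fintype.card α := Fintype.card_pos_iff.2 ⟨a⟩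
  have := sum_powerset_apply_card (fun m => f (m + 1)) (x := univ.erase a)
  rw [hc, Nat.sub_add_cancel hpos] at this
  rw [← this]
  refine sum_nbij' (fun S => S.erase a) (fun U => insert a U) ?_ ?_ ?_ ?_ ?_
  · intro S _
    simpa using erase_subset_erase a (subset_univ S)
  · simp
  · intro S hS
    exact insert_erase (by simpa using hS)
  · intro U hU
    exact erase_insert fun h => by simpa using mem_powerset.1 hU h
  · intro S hS
    rw [card_erase_add_one (by simpa using hS)]

/-- The number of transitive commuting `ℓ`-tuples in `S_m`, divided by `(m - 1)!`. -/
noncomputable def transitiveNumber (ℓ m : ℕ) : ℝ :=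
  Nat.card (transitiveCommutingPerms (Fin ℓ) (Fin m)) / (m - 1).factorial

theorem card_commutingTuples_succ (ℓ n : ℕ) :
    Nat.card (commutingTuples ℓ (n + 1)) = ∑ m ∈ range (n + 1),
      n.choose m * (Nat.card (transitiveCommutingPerms (Fin ℓ) (Fin (m + 1))) *
        Nat.card (commutingTuples ℓ (n - m))) := by
  have h := card_commutingPerms_eq_sum (ι := Fin ℓ) (0 : Fin (n + 1))
  have h' := sum_filter_mem_apply_card (0 : Fin (n + 1)) fun m =>
    Nat.card (transitiveCommutingPerms (Fin ℓ) (Fin m)) *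
      Nat.card (commutingPerms (Fin ℓ) (Fin (n + 1 - m)))
  simp only [Fintype.card_fin, Nat.add_sub_cancel, smul_eq_mul] at h'
  refine h.trans (Eq.trans (sum_congr rfl fun S hS => ?_) (h'.trans
    (sum_congr rfl fun m _ => by rw [Nat.add_sub_add_right]; rfl)))
  rw [card_commutingPermsOfOrbit _ _ (by simpa using hS),
    card_transitiveCommutingPerms_congr (β := Fin S.card) S.equivFin,
    card_commutingPerms_congr (β := Fin (n + 1 - S.card))
      (Fintype.equivFinOfCardEq (by simp [Fintype.card_subtype_compl]))]

/-- Exponential formula: sorting by the orbit of one point gives the recurrence of `expSeq`, because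
`n.choose m / n! = 1 / (m! (n - m)!)` is absorbed by the normalisations. -/
theorem commutingNumber_eq_expSeq (ℓ n : ℕ) :
    (commutingNumber ℓ n : ℝ) = expSeq (transitiveNumber ℓ) n := by
  refine eq_expSeq (f := fun n => (commutingNumber ℓ n : ℝ)) ?_ (fun n => ?_) n
  · have : Nat.card (commutingTuples ℓ 0) = 1 := by
      rw [Nat.card_eq_one_iff_unique]
      exact ⟨inferInstance, ⟨1, fun _ _ => rfl⟩⟩
    simp [commutingNumber, this]
  · simp only [commutingNumber, card_commutingTuples_succ]
    push_cast
    rw [Nat.factorial_succ, sum_div, mul_sum]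
    refine sum_congr rfl fun m hm => ?_
    have hm' : m ≤ n := Nat.lt_succ_iff.1 (mem_range.1 hm)
    have hc : ((n.choose m : ℕ) : ℝ) * m.factorial * (n - m).factorial = n.factorial := by
      exact_mod_cast Nat.choose_mul_factorial_mul_factorial hm'
    have h1 : (m.factorial : ℝ) ≠ 0 := by positivity
    have h2 : ((n - m).factorial : ℝ) ≠ 0 := by positivity
    have h3 : (n.factorial : ℝ) ≠ 0 := by positivity
    rw [transitiveNumber]
    simp only [Nat.add_sub_cancel]
    push_cast
    field_simp
    rw [← hc]
    ring

/-! ### Tuples generating a given subgroup -/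

section Generating

variable {G : Type*} [Group G] [Finite G]

/-- The number of `ℓ`-tuples of elements of `G` that generate the subgroup `H`. -/
noncomputable def generatingCount (H : Subgroup G) (ℓ : ℕ) : ℕ :=
  Nat.card {π : Fin ℓ → G // Subgroup.closure (Set.range π) = H}

theorem sum_generatingCount [Fintype (Subgroup G)] (P : Subgroup G → Prop) [DecidablePred P]
    (ℓ : ℕ) :
    ∑ H with P H, generatingCount H ℓ =
      Nat.card {π : Fin ℓ → G // P (Subgroup.closure (Set.range π))} := by
  classical
  have := Fintype.ofFinite G
  simp only [generatingCount, Nat.card_eq_fintype_card, Fintype.card_subtype]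
  rw [card_eq_sum_card_fiberwise (f := fun π : Fin ℓ → G => Subgroup.closure (Set.range π))
    (t := univ.filter P)]
  · refine sum_congr rfl fun H hH => ?_
    rw [filter_filter]
    congr 1
    ext π
    simp only [mem_filter, mem_univ, true_and] at hH ⊢
    exact ⟨fun h => ⟨h ▸ hH, h⟩, fun h => h.2⟩
  · intro π hπ
    simpa using hπ

/-- The `|H| ^ ℓ` tuples in `H` are sorted by the subgroup they generate; inductively, the proper
subgroups contribute strictly smaller bases. -/
theorem generatingCount_hasGrowth (H : Subgroup G) :
    HasGrowth (fun ℓ => generatingCount H ℓ) (Nat.card H) 1 := by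
  classical
  have := Fintype.ofFinite (Subgroup G)
  induction H using WellFoundedLT.induction with
  | _ H ih =>
    have hpos : ∀ K : Subgroup G, 0 < (Nat.card K : ℝ) := fun K => by
      exact_mod_cast Nat.card_pos
    have htot : ∀ ℓ, ∑ K with K ≤ H, generatingCount K ℓ = Nat.card H ^ ℓ := by
      intro ℓ
      rw [sum_generatingCount]
      have e : {π : Fin ℓ → G // Subgroup.closure (Set.range π) ≤ H} ≃ (Fin ℓ → H) :=
        (Equiv.subtypeEquivRight fun π => by
          rw [Subgroup.closure_le, Set.range_subset_iff]; rfl).trans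
          (Equiv.subtypePiEquivPi (p := fun _ g => g ∈ H))
      rw [Nat.card_congr e, Nat.card_fun, Nat.card_eq_fintype_card (α := Fin ℓ), Fintype.card_fin]
    have hsplit : (univ.filter (· ≤ H)) = insert H (univ.filter (· < H)) := by
      ext K
      simp [le_iff_eq_or_lt]
    have hsum : HasGrowth (fun ℓ => ∑ K with K < H, (generatingCount K ℓ : ℝ)) (Nat.card H)
        (∑ K with K < H, 0) := by
      refine HasGrowth.sum _ fun K hK => ?_
      have hK' : K < H := by simpa using hK
      refine (ih K hK').weaken (hpos K) ?_
      norm_cast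
      exact lt_of_le_of_ne (Subgroup.card_le_of_le hK'.le) fun h =>
        hK'.ne (Subgroup.eq_of_le_of_card_ge hK'.le h.ge)
    refine ((HasGrowth.base_pow (hpos H).ne').sub hsum).congr (fun ℓ => ?_) rfl (by simp)
    have := htot ℓ
    rw [hsplit, sum_insert (by simp)] at this
    have h2 : (generatingCount H ℓ : ℝ) + ∑ K with K < H, (generatingCount K ℓ : ℝ) =
        (Nat.card H : ℝ) ^ ℓ := by exact_mod_cast this
    linarith

end Generating

/-! ### Transitive abelian groups and the growth of `transitiveNumber` -/

/-- A subgroup of `S_m` is regular abelian if it is commutative and transitive. -/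
def IsRegularAbelian {m : ℕ} (H : Subgroup (Equiv.Perm (Fin m))) : Prop :=
  (∀ g ∈ H, ∀ h ∈ H, g * h = h * g) ∧ ∀ x y, ∃ g ∈ H, g x = y

/-- Some `k ∈ H` moves `x` to any given point, and `g`, `h` commute with `k`, so agreement at `x`
propagates. -/
theorem IsRegularAbelian.eq_of_apply_eq {m : ℕ} {H : Subgroup (Equiv.Perm (Fin m))}
    (hH : IsRegularAbelian H) {g h : Equiv.Perm (Fin m)} (hg : g ∈ H) (hh : h ∈ H) {x : Fin m}
    (e : g x = h x) : g = h := by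
  ext y
  obtain ⟨k, hk, rfl⟩ := hH.2 x y
  rw [← Equiv.Perm.mul_apply, ← Equiv.Perm.mul_apply, hH.1 g hg k hk, hH.1 h hh k hk,
    Equiv.Perm.mul_apply, Equiv.Perm.mul_apply, e]

theorem IsRegularAbelian.card_eq {m : ℕ} [NeZero m] {H : Subgroup (Equiv.Perm (Fin m))}
    (hH : IsRegularAbelian H) : Nat.card H = m := by
  have : Function.Bijective fun g : H => (g : Equiv.Perm (Fin m)) 0 := by
    refine ⟨fun g h e => Subtype.ext (hH.eq_of_apply_eq g.2 h.2 e), fun y => ?_⟩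
    obtain ⟨g, hg, e⟩ := hH.2 0 y
    exact ⟨⟨g, hg⟩, e⟩
  simpa using Nat.card_congr (Equiv.ofBijective _ this)

theorem mem_transitiveCommutingPerms_iff {ℓ m : ℕ} (π : Fin ℓ → Equiv.Perm (Fin m)) :
    π ∈ transitiveCommutingPerms (Fin ℓ) (Fin m) ↔
      IsRegularAbelian (Subgroup.closure (Set.range π)) := by
  refine and_congr ⟨fun h => ?_, fun h j k => ?_⟩ Iff.rfl
  · have hc : ∀ x ∈ Set.range π, ∀ y ∈ Set.range π, x * y = y * x := by
      rintro _ ⟨j, rfl⟩ _ ⟨k, rfl⟩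
      exact h j k
    intro g hg k hk
    exact congrArg Subtype.val
      ((Subgroup.isMulCommutative_closure hc).is_comm.comm ⟨g, hg⟩ ⟨k, hk⟩)
  · exact h _ (Subgroup.subset_closure ⟨j, rfl⟩) _ (Subgroup.subset_closure ⟨k, rfl⟩)

theorem transitiveNumber_hasGrowth (m : ℕ) (hm : 1 ≤ m) :
    HasGrowth (fun ℓ => transitiveNumber ℓ m) m
      ({H : Subgroup (Equiv.Perm (Fin m)) | IsRegularAbelian H}.ncard / (m - 1).factorial) := by
  classical
  have : NeZero m := ⟨by omega⟩
  have hfin := Fintype.ofFinite (Subgroup (Equiv.Perm (Fin m)))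
  refine HasGrowth.div_const ?_ _
  have h := HasGrowth.sum (B := (m : ℝ)) (C := fun _ => 1)
    (F := fun (H : Subgroup (Equiv.Perm (Fin m))) ℓ => (generatingCount H ℓ : ℝ))
    (univ.filter IsRegularAbelian) fun H hH => by
      have h := generatingCount_hasGrowth H
      rwa [IsRegularAbelian.card_eq (by simpa using hH : IsRegularAbelian H)] at h
  refine h.congr (fun ℓ => ?_) rfl ?_
  · rw [← Nat.cast_sum, sum_generatingCount]
    congr 1
    exact Nat.card_congr (Equiv.subtypeEquivRight fun π =>
      (mem_transitiveCommutingPerms_iff π).symm)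
  · rw [Set.ncard_eq_toFinset_card']
    simp

theorem transitiveNumber_one (ℓ : ℕ) : transitiveNumber ℓ 1 = 1 := by
  have : Nat.card (transitiveCommutingPerms (Fin ℓ) (Fin 1)) = 1 := by
    rw [Nat.card_eq_one_iff_unique]
    exact ⟨inferInstance, ⟨1, fun _ _ => rfl, fun _ _ => ⟨1, one_mem _, Subsingleton.elim _ _⟩⟩⟩
  simp [transitiveNumber, this]

/-! ### Regular abelian subgroups in small degree -/

/-- Bounding the exponent by `m` makes the hypothesis decidable. -/
theorem isRegularAbelian_zpowers {m : ℕ} (c : Equiv.Perm (Fin m))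
    (h : ∀ x y, ∃ k : Fin m, (c ^ (k : ℕ)) x = y) : IsRegularAbelian (Subgroup.zpowers c) := by
  constructor
  · rintro _ ⟨i, rfl⟩ _ ⟨j, rfl⟩
    exact (Commute.refl c).zpow_zpow i j
  · intro x y
    obtain ⟨k, hk⟩ := h x y
    exact ⟨_, Subgroup.npow_mem_zpowers c k, hk⟩

theorem ncard_isRegularAbelian_pos {m : ℕ} (c : Equiv.Perm (Fin m))
    (h : ∀ x y, ∃ k : Fin m, (c ^ (k : ℕ)) x = y) :
    0 < {H : Subgroup (Equiv.Perm (Fin m)) | IsRegularAbelian H}.ncard :=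
  (Set.ncard_pos (Set.toFinite _)).2 ⟨_, isRegularAbelian_zpowers c h⟩

theorem ncard_isRegularAbelian_two :
    {H : Subgroup (Equiv.Perm (Fin 2)) | IsRegularAbelian H}.ncard = 1 := by
  have htop : ∀ {H : Subgroup (Equiv.Perm (Fin 2))}, IsRegularAbelian H → H = ⊤ := fun hH =>
    Subgroup.eq_top_of_card_eq _
      (by rw [hH.card_eq, Nat.card_eq_fintype_card, Fintype.card_perm, Fintype.card_fin]; rfl)
  refine le_antisymm ((Set.ncard_le_one_iff (Set.toFinite _)).2 fun {H K} hH hK => ?_)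
    (ncard_isRegularAbelian_pos (finRotate 2) (by decide))
  rw [htop hH, htop hK]

/-- The regular Klein four-group in `S_4`. -/
def kleinFourPerm : Subgroup (Equiv.Perm (Fin 4)) where
  carrier := {g | g * g = 1 ∧ (g = 1 ∨ ∀ x, g x ≠ x)}
  one_mem' := by simp
  mul_mem' := by
    have h : ∀ g : Equiv.Perm (Fin 4), g * g = 1 ∧ (g = 1 ∨ ∀ x, g x ≠ x) →
      ∀ h : Equiv.Perm (Fin 4), h * h = 1 ∧ (h = 1 ∨ ∀ x, h x ≠ x) →
        g * h * (g * h) = 1 ∧ (g * h = 1 ∨ ∀ x, (g * h) x ≠ x) := by decide +kernel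
    exact fun {a b} ha hb => h a ha b hb
  inv_mem' := by
    have h : ∀ g : Equiv.Perm (Fin 4), g * g = 1 ∧ (g = 1 ∨ ∀ x, g x ≠ x) →
        g⁻¹ * g⁻¹ = 1 ∧ (g⁻¹ = 1 ∨ ∀ x, g⁻¹ x ≠ x) := by decide +kernel
    exact fun {a} ha => h a ha

theorem mem_kleinFourPerm {g : Equiv.Perm (Fin 4)} :
    g ∈ kleinFourPerm ↔ g * g = 1 ∧ (g = 1 ∨ ∀ x, g x ≠ x) := Iff.rfl

theorem isRegularAbelian_kleinFourPerm : IsRegularAbelian kleinFourPerm := by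
  simp only [IsRegularAbelian, mem_kleinFourPerm]
  constructor
  · decide +kernel
  · decide +kernel

/-- Representatives of the three pairs of mutually inverse `4`-cycles in `S_4`. -/
def fourCycle : Fin 3 → Equiv.Perm (Fin 4) :=
  ![finRotate 4, Equiv.swap 2 3 * finRotate 4 * Equiv.swap 2 3,
    Equiv.swap 1 2 * finRotate 4 * Equiv.swap 1 2]

theorem isRegularAbelian_zpowers_fourCycle (i : Fin 3) :
    IsRegularAbelian (Subgroup.zpowers (fourCycle i)) := by
  refine isRegularAbelian_zpowers _ ?_
  revert i
  decide +kernel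

theorem isRegularAbelian_four_iff (H : Subgroup (Equiv.Perm (Fin 4))) :
    IsRegularAbelian H ↔ H = kleinFourPerm ∨ ∃ i, Subgroup.zpowers (fourCycle i) = H := by
  constructor
  · intro hH
    have hfix : ∀ g ∈ H, g = 1 ∨ ∀ x, g x ≠ x := fun g hg => by
      by_contra! h
      obtain ⟨x, hx⟩ := h.2
      exact h.1 (hH.eq_of_apply_eq hg (one_mem H) hx)
    have heq : ∀ {K L : Subgroup (Equiv.Perm (Fin 4))}, IsRegularAbelian K →
        IsRegularAbelian L → K ≤ L → K = L := fun hK hL hle =>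
      Subgroup.eq_of_le_of_card_ge hle (by rw [hK.card_eq, hL.card_eq])
    -- A fixed-point-free permutation of four points is a double transposition or a 4-cycle.
    have hclass : ∀ g : Equiv.Perm (Fin 4), (g = 1 ∨ ∀ x, g x ≠ x) →
        g * g = 1 ∨ ∃ i, g = fourCycle i ∨ g⁻¹ = fourCycle i := by decide +kernel
    by_cases h : ∀ g ∈ H, g * g = 1
    · exact Or.inl (heq hH isRegularAbelian_kleinFourPerm fun g hg => ⟨h g hg, hfix g hg⟩)
    · push Not at h
      obtain ⟨g, hg, hgg⟩ := h
      obtain ⟨i, hi⟩ := (hclass g (hfix g hg)).resolve_left hgg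
      refine Or.inr ⟨i, heq (isRegularAbelian_zpowers_fourCycle i) hH ?_⟩
      rw [Subgroup.zpowers_le]
      rcases hi with hi | hi
      · exact hi ▸ hg
      · exact hi ▸ inv_mem hg
  · rintro (rfl | ⟨i, rfl⟩)
    · exact isRegularAbelian_kleinFourPerm
    · exact isRegularAbelian_zpowers_fourCycle i

theorem ncard_isRegularAbelian_four :
    {H : Subgroup (Equiv.Perm (Fin 4)) | IsRegularAbelian H}.ncard = 4 := by
  have e : {H : Subgroup (Equiv.Perm (Fin 4)) | IsRegularAbelian H} =
      insert kleinFourPerm (Set.range fun i => Subgroup.zpowers (fourCycle i)) :=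
    Set.ext isRegularAbelian_four_iff
  have hinj : Function.Injective fun i => Subgroup.zpowers (fourCycle i) := by
    -- Generators of the same cyclic group commute, so it suffices that distinct representatives do
    -- not.
    have hne : ∀ i j, fourCycle i * fourCycle j = fourCycle j * fourCycle i → i = j := by
      decide +kernel
    intro i j h
    have h' : Subgroup.zpowers (fourCycle i) = Subgroup.zpowers (fourCycle j) := h
    exact hne i j ((isRegularAbelian_zpowers_fourCycle j).1 _
      (h' ▸ Subgroup.mem_zpowers _) _ (Subgroup.mem_zpowers _))
  rw [e, Set.ncard_insert_of_notMem, ← Set.image_univ, Set.ncard_image_of_injective _ hinj,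
    Set.ncard_univ, Nat.card_eq_fintype_card, Fintype.card_fin]
  rintro ⟨i, hi⟩
  have hsq : ∀ i, fourCycle i * fourCycle i ≠ 1 := by decide +kernel
  have hmem : fourCycle i ∈ kleinFourPerm := by
    rw [← hi]
    exact Subgroup.mem_zpowers _
  exact hsq i hmem.1

/-! ### Tuples without orbits of length 3 -/

/-- The sequence `transitiveNumber ℓ` with its value at `3` replaced by `0`. -/
noncomputable def transitiveNumberErase (ℓ : ℕ) : ℕ → ℝ :=
  Function.update (transitiveNumber ℓ) 3 0

/-- The analogue of `commutingNumber ℓ` counting only tuples without orbits of length `3`. -/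
noncomputable def commutingNumberErase (ℓ : ℕ) : ℕ → ℝ :=
  expSeq (transitiveNumberErase ℓ)

/-- The limit of `transitiveNumberErase ℓ m / (√2) ^ (m * ℓ)` as `ℓ` tends to infinity. -/
noncomputable def eraseLimit (m : ℕ) : ℝ :=
  if m = 2 then 1 else if m = 4 then 2 / 3 else 0

/-- The limit of `transitiveNumber ℓ m / m ^ ℓ` as `ℓ` tends to infinity. -/
noncomputable def transitiveLimit (m : ℕ) : ℝ :=
  {H : Subgroup (Equiv.Perm (Fin m)) | IsRegularAbelian H}.ncard / (m - 1).factorial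

theorem transitiveLimit_two : transitiveLimit 2 = 1 := by
  simp [transitiveLimit, ncard_isRegularAbelian_two]

theorem transitiveLimit_three_pos : 0 < transitiveLimit 3 := by
  have := ncard_isRegularAbelian_pos (finRotate 3) (by decide +kernel)
  unfold transitiveLimit
  positivity

theorem transitiveLimit_four : transitiveLimit 4 = 2 / 3 := by
  simp only [transitiveLimit, ncard_isRegularAbelian_four]
  norm_num [Nat.factorial]

theorem transitiveLimit_five_pos : 0 < transitiveLimit 5 := by
  have := ncard_isRegularAbelian_pos (finRotate 5) (by decide +kernel)
  unfold transitiveLimit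
  positivity

theorem transitiveNumberErase_hasGrowth_nat {m : ℕ} (hm : 1 ≤ m) (h3 : m ≠ 3) :
    HasGrowth (fun ℓ => transitiveNumberErase ℓ m) m (transitiveLimit m) :=
  (transitiveNumber_hasGrowth m hm).congr (fun ℓ => by simp [transitiveNumberErase, h3]) rfl rfl

theorem transitiveNumberErase_one (ℓ : ℕ) : transitiveNumberErase ℓ 1 = 1 := by
  simp [transitiveNumberErase, transitiveNumber_one]

theorem transitiveNumberErase_three (ℓ : ℕ) : transitiveNumberErase ℓ 3 = 0 := by
  simp [transitiveNumberErase]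

theorem sqrt_two_pow_two_mul (n : ℕ) : √(2 : ℝ) ^ (2 * n) = 2 ^ n := by
  rw [pow_mul, Real.sq_sqrt zero_le_two]

/-- Equivalent to `m ^ 2 < 2 ^ m`, which is an equality at `m = 2, 4` and fails at the erased value
`m = 3`. Hence only orbits of length `2` and `4` enter `eraseLimit`. -/
theorem natCast_lt_sqrt_two_pow {m : ℕ} (h : m = 1 ∨ 5 ≤ m) : (m : ℝ) < √2 ^ m := by
  have h2 : m ^ 2 < 2 ^ m := by
    rcases h with rfl | h
    · norm_num
    · induction m, h using Nat.le_induction with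
      | base => norm_num
      | succ m hm ih => rw [pow_succ 2]; nlinarith
  refine lt_of_pow_lt_pow_left₀ 2 (by positivity) ?_
  rw [← pow_mul, mul_comm m 2, sqrt_two_pow_two_mul]
  exact_mod_cast h2

theorem transitiveNumberErase_hasGrowth (m : ℕ) (hm : 1 ≤ m) :
    HasGrowth (fun ℓ => transitiveNumberErase ℓ m) (√2 ^ m) (eraseLimit m) := by
  by_cases h3 : m = 3
  · subst h3
    exact (HasGrowth.zero).congr (fun ℓ => (transitiveNumberErase_three ℓ).symm) rfl
      (by simp [eraseLimit])
  have h := transitiveNumberErase_hasGrowth_nat hm h3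
  by_cases h2 : m = 2
  · subst h2
    exact h.congr (fun _ => rfl) (by simp) (by simp [eraseLimit, transitiveLimit_two])
  by_cases h4 : m = 4
  · subst h4
    refine h.congr (fun _ => rfl) ?_ (by simp [eraseLimit, transitiveLimit_four])
    rw [sqrt_two_pow_two_mul 2]
    norm_num
  · have := h.weaken (by positivity) (natCast_lt_sqrt_two_pow (m := m) (by omega))
    simpa [eraseLimit, h2, h4] using this

theorem commutingNumberErase_hasGrowth (n : ℕ) :
    HasGrowth (fun ℓ => commutingNumberErase ℓ n) (√2 ^ n) (expSeq eraseLimit n) :=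
  expSeq_hasGrowth transitiveNumberErase_hasGrowth n

/-- These are coefficients of `exp (X ^ 2 / 2 + X ^ 4 / 6)`. -/
theorem expSeq_eraseLimit : expSeq eraseLimit 2 = 1 / 2 ∧ expSeq eraseLimit 4 = 7 / 24 ∧
    expSeq eraseLimit 6 = 5 / 48 ∧ expSeq eraseLimit 8 = 43 / 1152 ∧
      expSeq eraseLimit 10 = 41 / 3840 := by
  have h1 : expSeq eraseLimit 1 = 0 := by
    simp [expSeq_succ, eraseLimit]
  have h2 : expSeq eraseLimit 2 = 1 / 2 := by
    rw [expSeq_succ]; norm_num [sum_range_succ, eraseLimit]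
  have h3 : expSeq eraseLimit 3 = 0 := by
    rw [expSeq_succ]; norm_num [sum_range_succ, eraseLimit, h1]
  have h4 : expSeq eraseLimit 4 = 7 / 24 := by
    rw [expSeq_succ]; norm_num [sum_range_succ, eraseLimit, h2]
  have h6 : expSeq eraseLimit 6 = 5 / 48 := by
    rw [expSeq_succ]; norm_num [sum_range_succ, eraseLimit, h2, h4]
  have h8 : expSeq eraseLimit 8 = 43 / 1152 := by
    rw [expSeq_succ]; norm_num [sum_range_succ, eraseLimit, h6, h4]
  have h10 : expSeq eraseLimit 10 = 41 / 3840 := by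
    rw [expSeq_succ]; norm_num [sum_range_succ, eraseLimit, h8, h6]
  exact ⟨h2, h4, h6, h8, h10⟩

theorem commutingNumberErase_hasGrowth_even {n : ℕ} {c : ℝ} (h : expSeq eraseLimit (2 * n) = c) :
    HasGrowth (fun ℓ => commutingNumberErase ℓ (2 * n)) (2 ^ n) c :=
  (commutingNumberErase_hasGrowth (2 * n)).congr (fun _ => rfl) (sqrt_two_pow_two_mul n) h

theorem commutingNumberErase_zero (ℓ : ℕ) : commutingNumberErase ℓ 0 = 1 := expSeq_zero _

theorem commutingNumberErase_succ (ℓ n : ℕ) : commutingNumberErase ℓ (n + 1) =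
    (∑ m ∈ range (n + 1), transitiveNumberErase ℓ (m + 1) * commutingNumberErase ℓ (n - m)) /
      (n + 1) := expSeq_succ _ _

theorem commutingNumberErase_one (ℓ : ℕ) : commutingNumberErase ℓ 1 = 1 := by
  simp [commutingNumberErase, expSeq_succ, transitiveNumberErase_one]

theorem commutingNumberErase_two_hasGrowth :
    HasGrowth (fun ℓ => commutingNumberErase ℓ 2) 2 (1 / 2) := by
  simpa using commutingNumberErase_hasGrowth_even (n := 1) expSeq_eraseLimit.1

/-- In odd degree the limit on the scale `√2 ^ n` is `0`, so the true rates in degrees `3`, `5`, `7`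
are read off from the recurrence. -/
theorem commutingNumberErase_three_hasGrowth :
    HasGrowth (fun ℓ => commutingNumberErase ℓ 3) 2 (1 / 2) := by
  have s2 := transitiveNumberErase_hasGrowth_nat (m := 2) (by norm_num) (by norm_num)
  refine ((commutingNumberErase_two_hasGrowth.add s2).div_const 3).congr (fun ℓ => ?_)
    (by norm_num) (by rw [transitiveLimit_two]; norm_num)
  have e : commutingNumberErase ℓ 3 = _ := commutingNumberErase_succ ℓ 2
  rw [e]
  norm_num [sum_range_succ, commutingNumberErase_one, transitiveNumberErase_one,
    transitiveNumberErase_three]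

theorem commutingNumberErase_four_hasGrowth :
    HasGrowth (fun ℓ => commutingNumberErase ℓ 4) 4 (7 / 24) :=
  (commutingNumberErase_hasGrowth_even (n := 2) expSeq_eraseLimit.2.1).congr (fun _ => rfl)
    (by norm_num) rfl

theorem commutingNumberErase_five_hasGrowth :
    HasGrowth (fun ℓ => commutingNumberErase ℓ 5) 5 (transitiveLimit 5 / 5) := by
  have s2 := transitiveNumberErase_hasGrowth_nat (m := 2) (by norm_num) (by norm_num)
  have s4 := transitiveNumberErase_hasGrowth_nat (m := 4) (by norm_num) (by norm_num)
  have s5 := transitiveNumberErase_hasGrowth_nat (m := 5) (by norm_num) (by norm_num)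
  refine (((((commutingNumberErase_four_hasGrowth.weaken (B := (5 : ℕ)) (by norm_num)
    (by norm_num)).add ((s2.mul commutingNumberErase_three_hasGrowth).weaken (by norm_num)
    (by norm_num))).add (s4.weaken (by norm_num) (by norm_num))).add s5).div_const 5).congr
    (fun ℓ => ?_) (by norm_num) (by norm_num)
  have e : commutingNumberErase ℓ 5 = _ := commutingNumberErase_succ ℓ 4
  rw [e]
  norm_num [sum_range_succ, commutingNumberErase_zero, commutingNumberErase_one,
    transitiveNumberErase_one, transitiveNumberErase_three]

/-- Without threes, the largest product of parts is `2 * 5 = 10`; every other partition has product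
at most `8`. -/
theorem commutingNumberErase_seven_hasGrowth :
    HasGrowth (fun ℓ => commutingNumberErase ℓ 7) 10 (transitiveLimit 5 / 10) := by
  have s2 := transitiveNumberErase_hasGrowth_nat (m := 2) (by norm_num) (by norm_num)
  have s4 := transitiveNumberErase_hasGrowth_nat (m := 4) (by norm_num) (by norm_num)
  have s5 := transitiveNumberErase_hasGrowth_nat (m := 5) (by norm_num) (by norm_num)
  have s6 := transitiveNumberErase_hasGrowth_nat (m := 6) (by norm_num) (by norm_num)
  have s7 := transitiveNumberErase_hasGrowth_nat (m := 7) (by norm_num) (by norm_num)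
  have g6 := commutingNumberErase_hasGrowth_even (n := 3) expSeq_eraseLimit.2.2.1
  have t1 := g6.weaken (B := 10) (by norm_num) (by norm_num)
  have t2 := (s2.mul commutingNumberErase_five_hasGrowth).congr (A := 10) (fun _ => rfl)
    (by norm_num) rfl
  have t4 := (s4.mul commutingNumberErase_three_hasGrowth).weaken (B := 10) (by norm_num)
    (by norm_num)
  have t5 := (s5.mul commutingNumberErase_two_hasGrowth).congr (A := 10) (fun _ => rfl)
    (by norm_num) rfl
  have t6 := s6.weaken (B := 10) (by norm_num) (by norm_num)
  have t7 := s7.weaken (B := 10) (by norm_num) (by norm_num)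
  refine ((((((t1.add t2).add t4).add t5).add t6).add t7).div_const 7).congr
    (fun ℓ => ?_) rfl (by rw [transitiveLimit_two]; ring)
  have e : commutingNumberErase ℓ 7 = _ := commutingNumberErase_succ ℓ 6
  rw [e]
  norm_num [sum_range_succ, commutingNumberErase_zero, commutingNumberErase_one,
    transitiveNumberErase_one, transitiveNumberErase_three]

/-! ### Growth of `commutingNumber` by residue modulo 3 -/

theorem sqrt_two_pow_three_lt : √(2 : ℝ) ^ 3 < 3 := by
  refine lt_of_pow_lt_pow_left₀ 2 (by norm_num) ?_
  rw [← pow_mul, mul_comm, sqrt_two_pow_two_mul]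
  norm_num

theorem transitiveNumber_three_hasGrowth :
    HasGrowth (fun ℓ => transitiveNumber ℓ 3 / 3) 3 (transitiveLimit 3 / 3) :=
  ((transitiveNumber_hasGrowth 3 (by norm_num)).div_const 3).congr (fun _ => rfl)
    (by norm_num) rfl

theorem commutingNumber_three_mul_add (ℓ k : ℕ) {r : ℕ} (hr : r < 3) :
    (commutingNumber ℓ (3 * k + r) : ℝ) =
      expConv (transitiveNumber ℓ 3 / 3) k fun d => commutingNumberErase ℓ (3 * d + r) := by
  rw [commutingNumber_eq_expSeq, expSeq_three_mul_add _ _ hr]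
  rfl

/-- In residue `1` the term with `k + 1` threes and a fixed point is not dominant: its base `3 ^ (k
+ 1)` is below `3 ^ k * 4`. It is separated so that `E(4)` leads the rest. -/
theorem commutingNumber_three_mul_add_four (ℓ k : ℕ) :
    (commutingNumber ℓ (3 * k + 4) : ℝ) =
      (transitiveNumber ℓ 3 / 3) ^ (k + 1) / (k + 1).factorial +
        expConv (transitiveNumber ℓ 3 / 3) k fun d => commutingNumberErase ℓ (3 * d + 4) := by
  rw [show 3 * k + 4 = 3 * (k + 1) + 1 by ring, commutingNumber_three_mul_add _ _ (by norm_num),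
    expConv_succ, mul_zero, zero_add, commutingNumberErase_one, mul_one]
  rfl

theorem expConv_transitiveNumber_hasGrowth {f : ℕ → ℕ → ℝ} {r : ℕ} {c : ℕ → ℝ}
    (hf : ∀ d, HasGrowth (fun ℓ => f ℓ d) (√2 ^ (3 * d + 2 * r)) (c d)) (k : ℕ) :
    HasGrowth (fun ℓ => expConv (transitiveNumber ℓ 3 / 3) k (f ℓ)) (3 ^ k * 2 ^ r)
      ((transitiveLimit 3 / 3) ^ k / k.factorial * c 0) :=
  expConv_hasGrowth transitiveNumber_three_hasGrowth (by positivity) (by positivity)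
    sqrt_two_pow_three_lt (fun d => (hf d).congr (fun _ => rfl)
      (by rw [pow_add, pow_mul, sqrt_two_pow_two_mul, mul_comm]) rfl) k

theorem commutingNumber_hasGrowth_zero (k : ℕ) :
    HasGrowth (fun ℓ => commutingNumber ℓ (3 * k)) (3 ^ k * 1)
      ((transitiveLimit 3 / 3) ^ k / k.factorial * 1) :=
  (expConv_transitiveNumber_hasGrowth (r := 0)
    (fun d => commutingNumberErase_hasGrowth (3 * d)) k).congr
    (fun ℓ => (commutingNumber_three_mul_add ℓ k (r := 0) (by norm_num)).symm) (by norm_num)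
    (by simp)

theorem commutingNumber_hasGrowth_two (k : ℕ) :
    HasGrowth (fun ℓ => commutingNumber ℓ (3 * k + 2)) (3 ^ k * 2)
      ((transitiveLimit 3 / 3) ^ k / k.factorial * (1 / 2)) :=
  (expConv_transitiveNumber_hasGrowth (r := 1)
    (fun d => commutingNumberErase_hasGrowth (3 * d + 2)) k).congr
    (fun ℓ => (commutingNumber_three_mul_add ℓ k (r := 2) (by norm_num)).symm) (by norm_num)
    (by simp [expSeq_eraseLimit])

theorem commutingNumber_hasGrowth_four (k : ℕ) :
    HasGrowth (fun ℓ => commutingNumber ℓ (3 * k + 4)) (3 ^ k * 4)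
      ((transitiveLimit 3 / 3) ^ k / k.factorial * (7 / 24)) := by
  have h := expConv_transitiveNumber_hasGrowth (r := 2)
    (fun d => commutingNumberErase_hasGrowth (3 * d + 4)) k
  have h' := ((transitiveNumber_three_hasGrowth.pow (k + 1)).div_const
    (k + 1).factorial).weaken (B := 3 ^ k * 2 ^ 2) (by positivity)
    (by rw [pow_succ]; gcongr; norm_num)
  exact (h'.add h).congr (fun ℓ => (commutingNumber_three_mul_add_four ℓ k).symm) (by norm_num)
    (by simp [expSeq_eraseLimit])

/-! ### Comparison of leading terms -/

theorem two_mul_factorial_mul_factorial_le {i j : ℕ} (hi : 1 ≤ i) (hj : 1 ≤ j) :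
    2 * (i.factorial * j.factorial) ≤ (i + j).factorial := by
  obtain ⟨i, rfl⟩ := Nat.exists_eq_add_of_le' hi
  obtain ⟨j, rfl⟩ := Nat.exists_eq_add_of_le' hj
  rw [← Nat.add_choose_mul_factorial_mul_factorial (i + 1) (j + 1), mul_assoc]
  refine Nat.mul_le_mul_right _ ?_
  rw [← Nat.add_assoc, Nat.choose_succ_succ]
  exact Nat.add_le_add (Nat.choose_pos (by omega)) (Nat.choose_pos (by omega))

theorem bessenrodtOnoDelta_comm (ℓ a b : ℕ) :
    bessenrodtOnoDelta ℓ a b = bessenrodtOnoDelta ℓ b a := by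
  rw [bessenrodtOnoDelta, bessenrodtOnoDelta, mul_comm, add_comm]

theorem eventually_bessenrodtOnoDelta_pos_of_hasGrowth {a b : ℕ} {B c : ℝ}
    (h : HasGrowth (fun ℓ => (commutingNumber ℓ a * commutingNumber ℓ b : ℝ) -
      commutingNumber ℓ (a + b)) B c) (hB : 0 < B) (hc : 0 < c) :
    ∀ᶠ ℓ : ℕ in atTop, 0 < bessenrodtOnoDelta ℓ a b := by
  filter_upwards [h.eventually_pos hB hc] with ℓ hℓ
  rw [bessenrodtOnoDelta]
  exact_mod_cast hℓ

theorem eventually_bessenrodtOnoDelta_neg_of_hasGrowth {a b : ℕ} {B c : ℝ}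
    (h : HasGrowth (fun ℓ => (commutingNumber ℓ a * commutingNumber ℓ b : ℝ) -
      commutingNumber ℓ (a + b)) B c) (hB : 0 < B) (hc : c < 0) :
    ∀ᶠ ℓ : ℕ in atTop, bessenrodtOnoDelta ℓ a b < 0 := by
  filter_upwards [h.eventually_neg hB hc] with ℓ hℓ
  rw [bessenrodtOnoDelta]
  exact_mod_cast hℓ

/-- The bases agree. Since `(i + j)! ≥ 2 * i! * j!` for `i, j ≥ 1`, it is enough that `e < 2 * (c *
d)`. -/
theorem eventually_bessenrodtOnoDelta_pos {a b n i j : ℕ} {A B C c d e y : ℝ} (hi : 1 ≤ i)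
    (hj : 1 ≤ j) (hy : 0 < y) (hA : 0 < A) (hB : 0 < B) (hn : a + b = n) (hC : C = A * B)
    (ha : HasGrowth (fun ℓ => commutingNumber ℓ a) (3 ^ i * A) (y ^ i / i.factorial * c))
    (hb : HasGrowth (fun ℓ => commutingNumber ℓ b) (3 ^ j * B) (y ^ j / j.factorial * d))
    (hab : HasGrowth (fun ℓ => commutingNumber ℓ n) (3 ^ (i + j) * C)
      (y ^ (i + j) / (i + j).factorial * e)) (he : 0 < e) (hcde : e < 2 * (c * d)) :
    ∀ᶠ ℓ : ℕ in atTop, 0 < bessenrodtOnoDelta ℓ a b := by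
  subst hn hC
  refine eventually_bessenrodtOnoDelta_pos_of_hasGrowth
    (((ha.mul hb).congr (fun _ => rfl) (by ring) rfl).sub hab) (by positivity) ?_
  have hf : (2 * (i.factorial * j.factorial) : ℝ) ≤ (i + j).factorial := by
    exact_mod_cast two_mul_factorial_mul_factorial_le hi hj
  have h1 : y ^ (i + j) / (i + j).factorial * e ≤
      y ^ (i + j) / (2 * (i.factorial * j.factorial)) * e := by
    gcongr
  have h2 : y ^ (i + j) / (2 * (i.factorial * j.factorial)) * e <
      y ^ (i + j) / (2 * (i.factorial * j.factorial)) * (2 * (c * d)) := by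
    gcongr
  have h3 : y ^ (i + j) / (2 * (i.factorial * j.factorial)) * (2 * (c * d)) =
      y ^ i / i.factorial * c * (y ^ j / j.factorial * d) := by
    rw [pow_add]
    field_simp
  linarith

theorem eventually_bessenrodtOnoDelta_neg {a b n : ℕ} {A B C c d e : ℝ} (hn : a + b = n)
    (ha : HasGrowth (fun ℓ => commutingNumber ℓ a) A c)
    (hb : HasGrowth (fun ℓ => commutingNumber ℓ b) B d)
    (hab : HasGrowth (fun ℓ => commutingNumber ℓ n) C e) (hAB : 0 < A * B) (hC : A * B < C)
    (he : 0 < e) : ∀ᶠ ℓ : ℕ in atTop, bessenrodtOnoDelta ℓ a b < 0 := by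
  subst hn
  exact eventually_bessenrodtOnoDelta_neg_of_hasGrowth (((ha.mul hb).weaken hAB hC).sub hab)
    (hAB.trans hC) (by linarith)

theorem transitiveLimit_three_div_pos : 0 < transitiveLimit 3 / 3 :=
  div_pos transitiveLimit_three_pos three_pos

theorem delta_zero_zero_pos {i j : ℕ} (hi : 1 ≤ i) (hj : 1 ≤ j) :
    ∀ᶠ ℓ : ℕ in atTop, 0 < bessenrodtOnoDelta ℓ (3 * i) (3 * j) :=
  eventually_bessenrodtOnoDelta_pos hi hj transitiveLimit_three_div_pos (by norm_num)
    (by norm_num) (by ring) (by norm_num) (commutingNumber_hasGrowth_zero i)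
    (commutingNumber_hasGrowth_zero j) (commutingNumber_hasGrowth_zero (i + j)) (by norm_num)
    (by norm_num)

theorem delta_zero_two_pos {i j : ℕ} (hi : 1 ≤ i) (hj : 1 ≤ j) :
    ∀ᶠ ℓ : ℕ in atTop, 0 < bessenrodtOnoDelta ℓ (3 * i) (3 * j + 2) :=
  eventually_bessenrodtOnoDelta_pos hi hj transitiveLimit_three_div_pos (by norm_num)
    (by norm_num) (by ring) (by norm_num) (commutingNumber_hasGrowth_zero i)
    (commutingNumber_hasGrowth_two j) (commutingNumber_hasGrowth_two (i + j)) (by norm_num)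
    (by norm_num)

theorem delta_zero_four_pos {i j : ℕ} (hi : 1 ≤ i) (hj : 1 ≤ j) :
    ∀ᶠ ℓ : ℕ in atTop, 0 < bessenrodtOnoDelta ℓ (3 * i) (3 * j + 4) :=
  eventually_bessenrodtOnoDelta_pos hi hj transitiveLimit_three_div_pos (by norm_num)
    (by norm_num) (by ring) (by norm_num) (commutingNumber_hasGrowth_zero i)
    (commutingNumber_hasGrowth_four j) (commutingNumber_hasGrowth_four (i + j)) (by norm_num)
    (by norm_num)

theorem delta_two_two_pos {i j : ℕ} (hi : 1 ≤ i) (hj : 1 ≤ j) :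
    ∀ᶠ ℓ : ℕ in atTop, 0 < bessenrodtOnoDelta ℓ (3 * i + 2) (3 * j + 2) :=
  eventually_bessenrodtOnoDelta_pos hi hj transitiveLimit_three_div_pos (by norm_num)
    (by norm_num) (by ring) (by norm_num) (commutingNumber_hasGrowth_two i)
    (commutingNumber_hasGrowth_two j) (commutingNumber_hasGrowth_four (i + j)) (by norm_num)
    (by norm_num)

theorem delta_four_four_neg (i j : ℕ) :
    ∀ᶠ ℓ : ℕ in atTop, bessenrodtOnoDelta ℓ (3 * i + 4) (3 * j + 4) < 0 := by
  have := transitiveLimit_three_div_pos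
  refine eventually_bessenrodtOnoDelta_neg (n := 3 * (i + j + 2) + 2) (by ring)
    (commutingNumber_hasGrowth_four i) (commutingNumber_hasGrowth_four j)
    (commutingNumber_hasGrowth_two _) (by positivity) ?_ (by positivity)
  calc (3 : ℝ) ^ i * 4 * (3 ^ j * 4) = 3 ^ (i + j) * 16 := by ring
    _ < 3 ^ (i + j) * 18 := by gcongr; norm_num
    _ = _ := by ring

theorem delta_four_two_neg (i j : ℕ) :
    ∀ᶠ ℓ : ℕ in atTop, bessenrodtOnoDelta ℓ (3 * i + 4) (3 * j + 2) < 0 := by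
  have := transitiveLimit_three_div_pos
  refine eventually_bessenrodtOnoDelta_neg (n := 3 * (i + j + 2)) (by ring)
    (commutingNumber_hasGrowth_four i) (commutingNumber_hasGrowth_two j)
    (commutingNumber_hasGrowth_zero _) (by positivity) ?_ (by positivity)
  calc (3 : ℝ) ^ i * 4 * (3 ^ j * 2) = 3 ^ (i + j) * 8 := by ring
    _ < 3 ^ (i + j) * 9 := by gcongr; norm_num
    _ = _ := by ring

theorem commutingNumber_two_hasGrowth :
    HasGrowth (fun ℓ => commutingNumber ℓ 2) 2 (1 / 2) :=
  (commutingNumber_hasGrowth_two 0).congr (fun _ => rfl) (by norm_num) (by norm_num)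

/-- The bases agree and `2` contains no three, so both constants carry the same `y ^ i / i!` and the
sign is that of `1/4 - 7/24`. -/
theorem delta_two_neg (i : ℕ) :
    ∀ᶠ ℓ : ℕ in atTop, bessenrodtOnoDelta ℓ (3 * i + 2) 2 < 0 := by
  have := transitiveLimit_three_div_pos
  refine eventually_bessenrodtOnoDelta_neg_of_hasGrowth
    ((((commutingNumber_hasGrowth_two i).mul commutingNumber_two_hasGrowth).congr (fun _ => rfl)
      (by ring) rfl).sub (commutingNumber_hasGrowth_four i)) (by positivity) ?_
  have : 0 < (transitiveLimit 3 / 3) ^ i / i.factorial := by positivity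
  linarith

/-! ### Cancelling leading terms: `3 ∣ a` and `b = 2` or `b = 4` -/

theorem commutingNumber_two (ℓ : ℕ) : (commutingNumber ℓ 2 : ℝ) = commutingNumberErase ℓ 2 := by
  simpa [expConv] using commutingNumber_three_mul_add ℓ 0 (r := 2) (by norm_num)

theorem commutingNumber_four (ℓ : ℕ) :
    (commutingNumber ℓ 4 : ℝ) = transitiveNumber ℓ 3 / 3 + commutingNumberErase ℓ 4 := by
  simpa [expConv] using commutingNumber_three_mul_add_four ℓ 0

/-- The `d = 0` terms of both sides are the same multiple of `E(2)` and cancel exactly for each `ℓ`.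
-/
theorem delta_three_mul_two (ℓ i : ℕ) :
    (commutingNumber ℓ (3 * (i + 1)) * commutingNumber ℓ 2 : ℝ) -
        commutingNumber ℓ (3 * (i + 1) + 2) =
      expConv (transitiveNumber ℓ 3 / 3) i fun d =>
        commutingNumberErase ℓ (3 * (d + 1)) * commutingNumberErase ℓ 2 -
          commutingNumberErase ℓ (3 * (d + 1) + 2) := by
  have h := commutingNumber_three_mul_add ℓ (i + 1) (r := 0) (by norm_num)
  rw [add_zero] at h
  rw [h, commutingNumber_three_mul_add ℓ (i + 1) (by norm_num), commutingNumber_two, expConv_mul,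
    expConv_sub, expConv_succ]
  simp [commutingNumberErase_zero]

/-- The same cancellation for `E(4)`; the two extra terms come from a three and a fixed point in
degree `4`, and have base only `3 ^ (i + 2)`. -/
theorem delta_three_mul_four (ℓ i : ℕ) :
    (commutingNumber ℓ (3 * (i + 1)) * commutingNumber ℓ 4 : ℝ) -
        commutingNumber ℓ (3 * (i + 1) + 4) =
      commutingNumber ℓ (3 * (i + 1)) * (transitiveNumber ℓ 3 / 3) -
        (transitiveNumber ℓ 3 / 3) ^ (i + 2) / (i + 2).factorial +
      expConv (transitiveNumber ℓ 3 / 3) i fun d =>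
        commutingNumberErase ℓ (3 * (d + 1)) * commutingNumberErase ℓ 4 -
          commutingNumberErase ℓ (3 * (d + 1) + 4) := by
  have h := commutingNumber_three_mul_add ℓ (i + 1) (r := 0) (by norm_num)
  rw [add_zero] at h
  have key : (commutingNumber ℓ (3 * (i + 1)) : ℝ) * commutingNumberErase ℓ 4 -
      (expConv (transitiveNumber ℓ 3 / 3) (i + 1) fun d => commutingNumberErase ℓ (3 * d + 4)) =
      expConv (transitiveNumber ℓ 3 / 3) i fun d =>
        commutingNumberErase ℓ (3 * (d + 1)) * commutingNumberErase ℓ 4 -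
          commutingNumberErase ℓ (3 * (d + 1) + 4) := by
    rw [h, expConv_mul, expConv_sub, expConv_succ]
    simp [commutingNumberErase_zero]
  rw [← key, commutingNumber_four, commutingNumber_three_mul_add_four]
  ring

/-- The negative term, of base `3 ^ (i + 1) * 5`, loses to base `3 ^ i * 16`, whose constant has the
sign of `1/2 * 5/48 - 43/1152 = 17/1152`. -/
theorem delta_three_mul_two_pos (i : ℕ) :
    ∀ᶠ ℓ : ℕ in atTop, 0 < bessenrodtOnoDelta ℓ (3 * (i + 2)) 2 := by
  have hy := transitiveLimit_three_div_pos
  obtain ⟨h2, h4, h6, h8, h10⟩ := expSeq_eraseLimit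
  have hmain := expConv_transitiveNumber_hasGrowth (r := 4)
    (fun d => ((commutingNumberErase_hasGrowth (3 * (d + 2))).mul
      (commutingNumberErase_hasGrowth 2)).congr (A := √2 ^ (3 * d + 2 * 4)) (fun _ => rfl)
        (by ring) rfl |>.sub ((commutingNumberErase_hasGrowth (3 * (d + 2) + 2)).congr
          (fun _ => rfl) (by ring) rfl)) i
  have h1 := (((commutingNumberErase_three_hasGrowth.mul
    commutingNumberErase_two_hasGrowth).weaken (B := 5) (by norm_num) (by norm_num)).sub
    commutingNumberErase_five_hasGrowth)
  have h1' := (((transitiveNumber_three_hasGrowth.pow (i + 1)).div_const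
    (i + 1).factorial).mul h1).weaken (B := 3 ^ i * 2 ^ 4) (by positivity)
    (by rw [pow_succ, mul_assoc]; gcongr; norm_num)
  refine eventually_bessenrodtOnoDelta_pos_of_hasGrowth ((h1'.add hmain).congr (fun ℓ => ?_)
    rfl rfl) (by positivity) ?_
  · rw [delta_three_mul_two ℓ (i + 1), expConv_succ]
  · norm_num [h2, h6, h8]
    positivity

/-- Relative to `3 ^ i`, the bases `27` and `30` lose to `32`, whose constant has the sign of `5/48
* 7/24 - 41/3840 > 0`. -/
theorem delta_three_mul_four_pos (i : ℕ) :
    ∀ᶠ ℓ : ℕ in atTop, 0 < bessenrodtOnoDelta ℓ (3 * (i + 2)) 4 := by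
  have hy := transitiveLimit_three_div_pos
  obtain ⟨h2, h4, h6, h8, h10⟩ := expSeq_eraseLimit
  have hmain := expConv_transitiveNumber_hasGrowth (r := 5)
    (fun d => ((commutingNumberErase_hasGrowth (3 * (d + 2))).mul
      (commutingNumberErase_hasGrowth 4)).congr (A := √2 ^ (3 * d + 2 * 5)) (fun _ => rfl)
        (by ring) rfl |>.sub ((commutingNumberErase_hasGrowth (3 * (d + 2) + 4)).congr
          (fun _ => rfl) (by ring) rfl)) i
  have h1 := (((commutingNumberErase_three_hasGrowth.mul
    commutingNumberErase_four_hasGrowth).weaken (B := 10) (by norm_num) (by norm_num)).sub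
    commutingNumberErase_seven_hasGrowth)
  have h1' := (((transitiveNumber_three_hasGrowth.pow (i + 1)).div_const
    (i + 1).factorial).mul h1).weaken (B := 3 ^ i * 2 ^ 5) (by positivity)
    (by rw [pow_succ, mul_assoc]; gcongr; norm_num)
  have h0 := ((commutingNumber_hasGrowth_zero (i + 2)).mul
    transitiveNumber_three_hasGrowth).weaken (B := 3 ^ i * 2 ^ 5) (by positivity)
    (by rw [pow_add, mul_assoc, mul_assoc]; gcongr; norm_num)
  have h0' := ((transitiveNumber_three_hasGrowth.pow (i + 3)).div_const
    (i + 3).factorial).weaken (B := 3 ^ i * 2 ^ 5) (by positivity)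
    (by rw [pow_add]; gcongr; norm_num)
  refine eventually_bessenrodtOnoDelta_pos_of_hasGrowth
    (((h0.sub h0').add (h1'.add hmain)).congr (fun ℓ => ?_) rfl rfl) (by positivity) ?_
  · rw [delta_three_mul_four ℓ (i + 1), expConv_succ]
  · norm_num [h4, h6, h10]
    positivity

/-- Only `E(3) E(2) - E(5)` remains, and the 5-cycles in `E(5)` beat base `4`. -/
theorem delta_three_two_neg : ∀ᶠ ℓ : ℕ in atTop, bessenrodtOnoDelta ℓ 3 2 < 0 := by
  have h := (((commutingNumberErase_three_hasGrowth.mul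
    commutingNumberErase_two_hasGrowth).weaken (B := 5) (by norm_num) (by norm_num)).sub
    commutingNumberErase_five_hasGrowth)
  refine eventually_bessenrodtOnoDelta_neg_of_hasGrowth (h.congr (fun ℓ => ?_) rfl rfl)
    (by norm_num) (by linarith [transitiveLimit_five_pos])
  simpa [expConv] using (delta_three_mul_two ℓ 0).symm

/-- The base `10` of `E(7)` beats `8` from `E(3) E(4)` and `9` from the extra terms. -/
theorem delta_three_four_neg : ∀ᶠ ℓ : ℕ in atTop, bessenrodtOnoDelta ℓ 3 4 < 0 := by
  have h := (((commutingNumberErase_three_hasGrowth.mul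
    commutingNumberErase_four_hasGrowth).weaken (B := 10) (by norm_num) (by norm_num)).sub
    commutingNumberErase_seven_hasGrowth)
  have h0 := ((commutingNumber_hasGrowth_zero 1).mul
    transitiveNumber_three_hasGrowth).weaken (B := 10) (by positivity) (by norm_num)
  have h0' := ((transitiveNumber_three_hasGrowth.pow 2).div_const
    (2 : ℕ).factorial).weaken (B := 10) (by positivity) (by norm_num)
  refine eventually_bessenrodtOnoDelta_neg_of_hasGrowth
    (((h0.sub h0').add h).congr (fun ℓ => ?_) rfl rfl)
    (by norm_num) (by linarith [transitiveLimit_five_pos])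
  simpa [expConv] using (delta_three_mul_four ℓ 0).symm

/-! ### Case distinction modulo 3 -/

theorem delta_three_mul {b : ℕ} (i : ℕ) (hb : 2 ≤ b) :
    ((3 * (i + 1), b) ∉ ({(3, 2), (3, 4), (2, 3), (4, 3)} : Set (ℕ × ℕ)) →
      ∀ᶠ ℓ : ℕ in atTop, 0 < bessenrodtOnoDelta ℓ (3 * (i + 1)) b) ∧
    ((3 * (i + 1), b) ∈ ({(3, 2), (3, 4), (2, 3), (4, 3)} : Set (ℕ × ℕ)) →
      ∀ᶠ ℓ : ℕ in atTop, bessenrodtOnoDelta ℓ (3 * (i + 1)) b < 0) := by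
  simp only [Set.mem_insert_iff, Set.mem_singleton_iff, Prod.mk.injEq]
  constructor
  · intro h
    rcases (by omega : b % 3 = 0 ∨ b % 3 = 2 ∧ b ≠ 2 ∨ b % 3 = 1 ∧ b ≠ 4 ∨ b = 2 ∨ b = 4) with
      hb' | hb' | hb' | rfl | rfl
    · obtain ⟨j, rfl⟩ : ∃ j, b = 3 * (j + 1) := ⟨b / 3 - 1, by omega⟩
      exact delta_zero_zero_pos (by omega) (by omega)
    · obtain ⟨j, rfl⟩ : ∃ j, b = 3 * (j + 1) + 2 := ⟨b / 3 - 1, by omega⟩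
      exact delta_zero_two_pos (by omega) (by omega)
    · obtain ⟨j, rfl⟩ : ∃ j, b = 3 * (j + 1) + 4 := ⟨b / 3 - 2, by omega⟩
      exact delta_zero_four_pos (by omega) (by omega)
    · obtain ⟨k, rfl⟩ : ∃ k, i = k + 1 := ⟨i - 1, by omega⟩
      exact delta_three_mul_two_pos k
    · obtain ⟨k, rfl⟩ : ∃ k, i = k + 1 := ⟨i - 1, by omega⟩
      exact delta_three_mul_four_pos k
  · intro h
    obtain rfl : i = 0 := by omega
    rcases (by omega : b = 2 ∨ b = 4) with rfl | rfl
    · exact delta_three_two_neg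
    · exact delta_three_four_neg

end CommutingTuples

theorem mainTheorem1 (a b : ℕ) (ha : 2 ≤ a) (hb : 2 ≤ b) :
    ((a ≡ 0 [MOD 3] ∨ b ≡ 0 [MOD 3]) →
      ((a, b) ∉ ({(3, 2), (3, 4), (2, 3), (4, 3)} : Set (ℕ × ℕ)) →
        ∀ᶠ ℓ : ℕ in Filter.atTop, 0 < bessenrodtOnoDelta ℓ a b) ∧
      ((a, b) ∈ ({(3, 2), (3, 4), (2, 3), (4, 3)} : Set (ℕ × ℕ)) →
        ∀ᶠ ℓ : ℕ in Filter.atTop, bessenrodtOnoDelta ℓ a b < 0)) ∧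
    ((a ≡ 1 [MOD 3] ∨ a ≡ 2 [MOD 3]) → (b ≡ 1 [MOD 3] ∨ b ≡ 2 [MOD 3]) →
      ¬ (a ≡ 2 [MOD 3] ∧ b ≡ 2 [MOD 3]) →
        ∀ᶠ ℓ : ℕ in Filter.atTop, bessenrodtOnoDelta ℓ a b < 0) ∧
    (a ≡ 2 [MOD 3] → b ≡ 2 [MOD 3] →
      (2 < a ∧ 2 < b → ∀ᶠ ℓ : ℕ in Filter.atTop, 0 < bessenrodtOnoDelta ℓ a b) ∧
      (a = 2 ∨ b = 2 → ∀ᶠ ℓ : ℕ in Filter.atTop, bessenrodtOnoDelta ℓ a b < 0)) := by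
  simp only [Nat.ModEq]
  refine ⟨fun h => ?_, fun ha' hb' hab => ?_, fun ha' hb' => ⟨fun h => ?_, fun h => ?_⟩⟩
  · by_cases ha3 : 3 ∣ a
    · obtain ⟨i, rfl⟩ : ∃ i, a = 3 * (i + 1) := ⟨a / 3 - 1, by omega⟩
      exact delta_three_mul i hb
    · obtain ⟨i, rfl⟩ : ∃ i, b = 3 * (i + 1) := ⟨b / 3 - 1, by omega⟩
      have hswap : (a, 3 * (i + 1)) ∈ ({(3, 2), (3, 4), (2, 3), (4, 3)} : Set (ℕ × ℕ)) ↔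
          (3 * (i + 1), a) ∈ ({(3, 2), (3, 4), (2, 3), (4, 3)} : Set (ℕ × ℕ)) := by
        simp only [Set.mem_insert_iff, Set.mem_singleton_iff, Prod.mk.injEq]
        omega
      simp only [bessenrodtOnoDelta_comm _ a, hswap]
      exact delta_three_mul i ha
  · rcases (by omega : a % 3 = 1 ∨ a % 3 = 2 ∧ b % 3 = 1) with h | h
    · obtain ⟨i, rfl⟩ : ∃ i, a = 3 * i + 4 := ⟨(a - 4) / 3, by omega⟩
      rcases (by omega : b % 3 = 1 ∨ b % 3 = 2) with h' | h'
      · obtain ⟨j, rfl⟩ : ∃ j, b = 3 * j + 4 := ⟨(b - 4) / 3, by omega⟩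
        exact delta_four_four_neg i j
      · obtain ⟨j, rfl⟩ : ∃ j, b = 3 * j + 2 := ⟨(b - 2) / 3, by omega⟩
        exact delta_four_two_neg i j
    · obtain ⟨i, rfl⟩ : ∃ i, a = 3 * i + 2 := ⟨(a - 2) / 3, by omega⟩
      obtain ⟨j, rfl⟩ : ∃ j, b = 3 * j + 4 := ⟨(b - 4) / 3, by omega⟩
      simp only [bessenrodtOnoDelta_comm _ (3 * i + 2)]
      exact delta_four_two_neg j i
  · obtain ⟨i, rfl⟩ : ∃ i, a = 3 * i + 2 := ⟨(a - 2) / 3, by omega⟩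
    obtain ⟨j, rfl⟩ : ∃ j, b = 3 * j + 2 := ⟨(b - 2) / 3, by omega⟩
    exact delta_two_two_pos (by omega) (by omega)
  · rcases h with rfl | rfl
    · obtain ⟨j, rfl⟩ : ∃ j, b = 3 * j + 2 := ⟨(b - 2) / 3, by omega⟩
      simp only [bessenrodtOnoDelta_comm _ 2]
      exact delta_two_neg j
    · obtain ⟨i, rfl⟩ : ∃ i, a = 3 * i + 2 := ⟨(a - 2) / 3, by omega⟩
      exact delta_two_neg i
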